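/- Let $0<\beta<1$ and let $D_\beta=(D_\beta(t))_{t\ge 0}$ be a $\beta$-stable subordinator, i.e. a real Lévy process with $D_\beta(0)=0$ and almost surely nondecreasing paths, with zero drift and Lévy measure $\lambda_\beta(\mathrm{d}x)=\frac{\beta}{\Gamma(1-\beta)x^{1+\beta}}\mathbf 1_{(0,\infty)}(x)\,\mathrm{d}x$, so that for all $s>0$, $t\ge 0$, $$\mathbb{E}\,e^{-sD_\beta(t)}=\exp\Big(-t\int_0^\infty(1-e^{-sx})\,\lambda_\beta(\mathrm{d}x)\Big).$$ Then for every $t>0$ the random variable $D_\beta(t)$ has a density $f_\beta(\cdot,t)\ge 0$ with respect to Lebesgue measure that vanishes on $(-\infty,0]$ and is continuous on $(0,\infty)$, and for every $x>0$ $$f_\beta(x,t)=\frac{1}{\beta t^{1/\beta}}\,\mathrm{H}^{0,1}_{1,1}\left[\frac{x}{t^{1/\beta}}\,\middle|\,\begin{matrix}(1-1/\beta,\,1/\beta)\\(0,1)\end{matrix}\right].$$ Here $\mathrm{H}^{m,n}_{p,q}$ is Fox's $H$-function, $$\mathrm{H}^{m,n}_{p,q}\left[z\,\middle|\,\begin{matrix}(a_i,A_i)_{1,p}\\(b_j,B_j)_{1,q}\end{matrix}\right]=\frac{1}{2\pi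 i}\int_{c-i\infty}^{c+i\infty}\frac{\prod_{i=1}^{n}\Gamma(1-a_i-A_is)\prod_{j=1}^{m}\Gamma(b_j+B_js)}{\prod_{i=n+1}^{p}\Gamma(a_i+A_is)\prod_{j=m+1}^{q}\Gamma(1-b_j-B_js)}\,z^{-s}\,\mathrm{d}s,$$ where $0\le m\le q$, $0\le n\le p$, $A_i,B_j>0$, $a_i,b_j\in\mathbb{C}$, $z\ne 0$, $z^{-s}$ is taken with the principal branch, and $c$ is a real number such that the singularities of $\Gamma(b_j+B_js)$, $1\le j\le m$, lie to the left of the line $\operatorname{Re}s=c$ and those of $\Gamma(1-a_i-A_is)$, $1\le i\le n$, to its right. For the above parameters and $z=x/t^{1/\beta}$ with $x,t>0$, such $c$ exist, the integral converges absolutely for every such $c$, and its value does not depend on $c$. -/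

import Mathlib

open MeasureTheory ProbabilityTheory Filter Topology
open scoped NNReal ENNReal

/-! ### Fox's H-function -/

/-- The kernel `χ(s)` of Fox's function `H^{m,n}_{p,q}[· | (a_i, A_i)_{1,p}; (b_j, B_j)_{1,q}]`:
`∏_{i ≤ n} Γ(1 - a_i - A_i s) ∏_{j ≤ m} Γ(b_j + B_j s)` over
`∏_{n < i ≤ p} Γ(a_i + A_i s) ∏_{m < j ≤ q} Γ(1 - b_j - B_j s)`.
At a pole of a factor of the denominator the value is `0`, since Mathlib's `Γ` is `0` there;
this is the value of the entire function `1/Γ`. -/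
noncomputable def foxKernel (m n : ℕ) {p q : ℕ} (a : Fin p → ℂ) (A : Fin p → ℝ)
    (b : Fin q → ℂ) (B : Fin q → ℝ) (s : ℂ) : ℂ :=
  ((∏ i : Fin p with i.val < n, Complex.Gamma (1 - a i - A i * s)) *
      ∏ j : Fin q with j.val < m, Complex.Gamma (b j + B j * s)) /
    ((∏ i : Fin p with n ≤ i.val, Complex.Gamma (a i + A i * s)) *
      ∏ j : Fin q with m ≤ j.val, Complex.Gamma (1 - b j - B j * s))

/-- The vertical line `Re s = c` separates the singularities of the numerator: all singularities of
`Γ(b_j + B_j s)`, `j ≤ m`, lie to its left and all those of `Γ(1 - a_i - A_i s)`, `i ≤ n`, to its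
right. -/
structure IsFoxContour (m n : ℕ) {p q : ℕ} (a : Fin p → ℂ) (A : Fin p → ℝ)
    (b : Fin q → ℂ) (B : Fin q → ℝ) (c : ℝ) : Prop where
  left : ∀ j : Fin q, j.val < m → ∀ (k : ℕ) (s : ℂ), b j + B j * s = -(k : ℂ) → s.re < c
  right : ∀ i : Fin p, i.val < n → ∀ (k : ℕ) (s : ℂ), 1 - a i - A i * s = -(k : ℂ) → c < s.re

/-- The Mellin-Barnes integrand `χ(s) z^{-s}` at `s = c + i y`; the branch of `z^{-s}` is the
principal one. -/
noncomputable def foxIntegrand (m n : ℕ) {p q : ℕ} (a : Fin p → ℂ) (A : Fin p → ℝ)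
    (b : Fin q → ℂ) (B : Fin q → ℝ) (z : ℂ) (c y : ℝ) : ℂ :=
  foxKernel m n a A b B (c + y * Complex.I) * z ^ (-(c + y * Complex.I : ℂ))

/-- The integral `(2πi)⁻¹ ∫_{c-i∞}^{c+i∞} χ(s) z^{-s} ds`, parametrized by `s = c + i y`. -/
noncomputable def foxIntegral (m n : ℕ) {p q : ℕ} (a : Fin p → ℂ) (A : Fin p → ℝ)
    (b : Fin q → ℂ) (B : Fin q → ℝ) (z : ℂ) (c : ℝ) : ℂ :=
  (1 / (2 * Real.pi * Complex.I)) *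
    ∫ y : ℝ, foxIntegrand m n a A b B z c y * Complex.I

/-- `H^{m,n}_{p,q}[z | (a_i, A_i); (b_j, B_j)]` is well defined: the parameters are admissible,
there is a separating vertical line, the Mellin-Barnes integral converges absolutely along every
such line and its value does not depend on the line. -/
structure FoxHWellDefined (m n : ℕ) {p q : ℕ} (a : Fin p → ℂ) (A : Fin p → ℝ)
    (b : Fin q → ℂ) (B : Fin q → ℝ) (z : ℂ) : Prop where
  m_le : m ≤ q
  n_le : n ≤ p
  A_pos : ∀ i, 0 < A i
  B_pos : ∀ j, 0 < B j
  z_ne_zero : z ≠ 0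
  exists_contour : ∃ c : ℝ, IsFoxContour m n a A b B c
  integrable : ∀ c : ℝ, IsFoxContour m n a A b B c → Integrable (foxIntegrand m n a A b B z c)
  eq_of_contour : ∀ c c' : ℝ, IsFoxContour m n a A b B c → IsFoxContour m n a A b B c' →
    foxIntegral m n a A b B z c = foxIntegral m n a A b B z c'

open Classical in
/-- Fox's function `H^{m,n}_{p,q}[z | (a_i, A_i)_{1,p}; (b_j, B_j)_{1,q}]`: the Mellin-Barnes
integral along some separating vertical line (and `0` if there is none). It is used together with
`FoxHWellDefined`, which makes it independent of the line. -/
noncomputable def foxH (m n : ℕ) {p q : ℕ} (a : Fin p → ℂ) (A : Fin p → ℝ)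
    (b : Fin q → ℂ) (B : Fin q → ℝ) (z : ℂ) : ℂ :=
  if h : ∃ c : ℝ, IsFoxContour m n a A b B c then foxIntegral m n a A b B z h.choose else 0

/-! ### Subordinators -/

/-- A real Lévy process started at `0`: stationary and independent increments, stochastically
continuous. -/
structure IsLevyProcess {Ω : Type*} [MeasurableSpace Ω] (D : ℝ≥0 → Ω → ℝ) (P : Measure Ω) :
    Prop where
  measurable : ∀ t, Measurable (D t)
  zero : ∀ᵐ ω ∂P, D 0 ω = 0
  indep_increments : HasIndepIncrements D P
  stationary_increments : ∀ t h : ℝ≥0,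
    IdentDistrib (fun ω => D (t + h) ω - D t ω) (fun ω => D h ω - D 0 ω) P P
  stochastic_continuity : ∀ t : ℝ≥0, TendstoInMeasure P D (𝓝 t) (D t)

/-- A subordinator: a real Lévy process whose paths are almost surely nondecreasing. -/
structure IsSubordinator {Ω : Type*} [MeasurableSpace Ω] (D : ℝ≥0 → Ω → ℝ) (P : Measure Ω) :
    Prop extends IsLevyProcess D P where
  nondecreasing : ∀ᵐ ω ∂P, Monotone fun t => D t ω

/-- The Laplace exponent `ψ(s) = b s + ∫_{(0,∞)} (1 - e^{-s x}) ν(dx)` with drift `b` and Lévy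
measure `ν`. -/
noncomputable def laplaceExponent (b : ℝ) (ν : Measure ℝ) (s : ℝ) : ℝ :=
  b * s + ∫ x in Set.Ioi 0, (1 - Real.exp (-(s * x))) ∂ν

/-- A subordinator with drift `b ≥ 0` and Lévy measure `ν` (a measure on `(0,∞)` with
`∫ min(x,1) ν(dx) < ∞`), i.e. a subordinator with
`E e^{-s D(t)} = e^{-t ψ(s)}` for its Laplace exponent `ψ`. -/
structure IsSubordinatorWith {Ω : Type*} [MeasurableSpace Ω] (D : ℝ≥0 → Ω → ℝ) (P : Measure Ω)
    (b : ℝ) (ν : Measure ℝ) : Prop extends IsSubordinator D P where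
  drift_nonneg : 0 ≤ b
  levyMeasure_Iic : ν (Set.Iic 0) = 0
  levyMeasure_lt_top : ∫⁻ x, ENNReal.ofReal (min x 1) ∂ν < ∞
  laplace : ∀ (t : ℝ≥0) (s : ℝ), 0 < s →
    ∫ ω, Real.exp (-(s * D t ω)) ∂P = Real.exp (-(t * laplaceExponent b ν s))

/-- The Lévy measure `β / (Γ(1-β) x^{1+β}) 1_{(0,∞)}(x) dx`. -/
noncomputable def stableLevyMeasure (β : ℝ) : Measure ℝ :=
  (volume.restrict (Set.Ioi 0)).withDensity fun x =>
    ENNReal.ofReal (β / (Real.Gamma (1 - β) * x ^ (1 + β)))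

/-- A `β`-stable subordinator, `0 < β < 1`: a subordinator with zero drift and Lévy measure
`β / (Γ(1-β) x^{1+β}) 1_{(0,∞)}(x) dx`. -/
def IsStableSubordinator {Ω : Type*} [MeasurableSpace Ω] (D : ℝ≥0 → Ω → ℝ) (P : Measure Ω)
    (β : ℝ) : Prop :=
  IsSubordinatorWith D P 0 (stableLevyMeasure β)

/-! The proof is Mellin inversion. Let `μ` be the law of `D t`. Its Laplace transform is `exp (-t s
^ β)`, because the Laplace exponent of the given Lévy measure is `s ^ β`. Integrating `s ^ (r - 1)`
against this transform and swapping integrals gives the moments of negative order, `∫ x ^ (-r) dμ =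
β⁻¹ t ^ (-r / β) Γ(r / β) / Γ(r)` for `Re r > 0` (`integral_cpow_neg_of_laplace`). With `r = 1 - s`
this is, up to the scaling in `t`, the kernel of the H-function on the line `Re s = c`, for any `c <
1`.

On that line the moment is also the characteristic function of the image under `log` of `x ^ (-(1 -
c)) μ(dx)` (`charFun_logTilted`). Since `1 / β > 1`, the decay of `Γ(r / β)` beats the growth of `1
/ Γ(r)`, so this characteristic function is integrable (`integrable_Gamma_mul_div_Gamma`). Fourier
inversion (`eq_withDensity_charFunInv`) then yields a continuous nonnegative density, and undoing
the logarithm and the tilt turns the inversion integral into the Mellin-Barnes integral.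

No contour is shifted: every `c < 1` produces a density of the same `μ`, continuous on `(0,∞)`, and
two such densities agree everywhere there (`eqOn_mellinDensity`). -/

/-! ### Fourier inversion for finite measures on the line -/

theorem integral_cexp_quadratic_mul_charFun (ν : Measure ℝ) [IsFiniteMeasure ν] {b : ℂ}
    (hb : b.re < 0) (c d : ℂ) :
    ∫ ξ : ℝ, Complex.exp (b * ξ ^ 2 + c * ξ + d) * charFun ν ξ =
      ∫ u : ℝ, (Real.pi / -b) ^ (1 / 2 : ℂ) *
        Complex.exp (d - (c + u * Complex.I) ^ 2 / (4 * b)) ∂ν := by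
  have hint : Integrable (fun p : ℝ × ℝ => Complex.exp (b * p.1 ^ 2 + c * p.1 + d) *
      Complex.exp (p.1 * p.2 * Complex.I)) (volume.prod ν) := by
    have h1 : Integrable (fun p : ℝ × ℝ => Complex.exp (b * p.1 ^ 2 + c * p.1 + d) * (1 : ℂ))
        (volume.prod ν) :=
      (integrable_cexp_quadratic' hb c d).mul_prod (integrable_const (μ := ν) (1 : ℂ))
    refine h1.mono (by fun_prop) (ae_of_all _ fun p => ?_)
    simp only [norm_mul, norm_one]
    rw [show (p.1 * p.2 * Complex.I : ℂ) = ((p.1 * p.2 : ℝ) : ℂ) * Complex.I by push_cast; rfl,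
      Complex.norm_exp_ofReal_mul_I]
  simp_rw [charFun_apply_real, ← integral_const_mul]
  rw [integral_integral_swap hint]
  refine integral_congr_ae (ae_of_all _ fun u => ?_)
  simp only
  rw [← integral_cexp_quadratic hb]
  refine integral_congr_ae (ae_of_all _ fun ξ => ?_)
  simp only
  rw [← Complex.exp_add]
  congr 1
  ring

/-- The inverse Fourier transform of the characteristic function. -/
noncomputable def charFunInv (ν : Measure ℝ) (v : ℝ) : ℂ :=
  1 / (2 * Real.pi) * ∫ ξ : ℝ, Complex.exp (-(ξ * v * Complex.I)) * charFun ν ξ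

theorem norm_cexp_neg_mul_I (x y : ℝ) : ‖Complex.exp (-(x * y * Complex.I))‖ = 1 := by
  rw [show -(x * y * Complex.I : ℂ) = ((-(x * y) : ℝ) : ℂ) * Complex.I by push_cast; ring,
    Complex.norm_exp_ofReal_mul_I]

theorem continuous_charFunInv (ν : Measure ℝ) (h : Integrable (charFun ν)) : Continuous (charFunInv ν) := by
  unfold charFunInv
  refine continuous_const.mul ?_
  refine continuous_of_dominated (bound := fun ξ => ‖charFun ν ξ‖) (fun v => ?_) (fun v => ?_)
    h.norm (ae_of_all _ fun ξ => by fun_prop)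
  · exact (Continuous.aestronglyMeasurable (by fun_prop)).mul h.aestronglyMeasurable
  · exact ae_of_all _ fun ξ => by rw [norm_mul, norm_cexp_neg_mul_I, one_mul]

theorem norm_charFunInv_le (ν : Measure ℝ) (v : ℝ) :
    ‖charFunInv ν v‖ ≤ ‖(1 / (2 * Real.pi) : ℂ)‖ * ∫ ξ, ‖charFun ν ξ‖ := by
  unfold charFunInv
  rw [norm_mul]
  gcongr
  refine (norm_integral_le_integral_norm _).trans_eq ?_
  simp_rw [norm_mul, norm_cexp_neg_mul_I, one_mul]

/-- Damping the inversion integral by `exp (-b ξ ^ 2)` turns it into the integral of a positive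
Gaussian against `ν`; nonnegative reals are closed in `ℂ`, so the limit `b → 0` remains one. -/
theorem exists_charFunInv_eq_ofReal (ν : Measure ℝ) [IsFiniteMeasure ν] (h : Integrable (charFun ν)) (v : ℝ) :
    ∃ r : ℝ, 0 ≤ r ∧ charFunInv ν v = r := by
  have hlim : Tendsto (fun n : ℕ => ∫ ξ : ℝ,
      Complex.exp (-(1 / ((n : ℝ) + 1) : ℝ) * ξ ^ 2 + (-(v * Complex.I)) * ξ + 0) * charFun ν ξ)
      atTop (𝓝 (∫ ξ : ℝ, Complex.exp (-(ξ * v * Complex.I)) * charFun ν ξ)) := by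
    refine tendsto_integral_of_dominated_convergence (fun ξ => ‖charFun ν ξ‖)
      (fun n => (Continuous.aestronglyMeasurable (by fun_prop)).mul h.aestronglyMeasurable)
      h.norm (fun n => ae_of_all _ fun ξ => ?_) (ae_of_all _ fun ξ => ?_)
    · rw [norm_mul]
      refine mul_le_of_le_one_left (norm_nonneg _) ?_
      rw [Complex.norm_exp, Real.exp_le_one_iff]
      have : (-(1 / ((n : ℝ) + 1) : ℝ) * ξ ^ 2 + (-(v * Complex.I)) * ξ + 0 : ℂ).re =
          -(1 / ((n : ℝ) + 1) * ξ ^ 2) := by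
        have : (-(1 / ((n : ℝ) + 1) : ℝ) * ξ ^ 2 + (-(v * Complex.I)) * ξ + 0 : ℂ) =
          ((-(1 / ((n : ℝ) + 1) * ξ ^ 2) : ℝ) : ℂ) + ((-(v * ξ) : ℝ) : ℂ) * Complex.I := by
            push_cast; ring
        rw [this, Complex.add_re, Complex.ofReal_re, Complex.re_ofReal_mul, Complex.I_re, mul_zero,
          add_zero]
      rw [this, neg_nonpos]; positivity
    · refine Tendsto.mul_const _ ((Complex.continuous_exp.tendsto _).comp ?_)
      have h1 := (Complex.continuous_ofReal.tendsto _).comp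
        (tendsto_one_div_add_atTop_nhds_zero_nat (𝕜 := ℝ))
      have h2 := ((h1.neg.mul_const ((ξ : ℂ) ^ 2)).add_const ((-(v * Complex.I)) * ξ)).add_const 0
      rw [show -(ξ * v * Complex.I : ℂ) = -((0 : ℝ) : ℂ) * ξ ^ 2 + (-(v * Complex.I)) * ξ + 0 by
        rw [Complex.ofReal_zero]; ring]
      exact h2
  have hval : ∀ n : ℕ, ∃ r : ℝ, 0 ≤ r ∧ ∫ ξ : ℝ,
      Complex.exp (-(1 / ((n : ℝ) + 1) : ℝ) * ξ ^ 2 + (-(v * Complex.I)) * ξ + 0) * charFun ν ξ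
        = r := by
    intro n
    have hb : 0 < 1 / ((n : ℝ) + 1) := by positivity
    generalize 1 / ((n : ℝ) + 1) = b at hb
    refine ⟨∫ u : ℝ, (Real.pi / b) ^ (1 / 2 : ℝ) * Real.exp (-((u - v) ^ 2 / (4 * b))) ∂ν,
      integral_nonneg fun u => by positivity, ?_⟩
    rw [integral_cexp_quadratic_mul_charFun ν (by simpa using hb), ← integral_complex_ofReal]
    refine integral_congr_ae (ae_of_all _ fun u => ?_)
    simp only
    rw [Complex.ofReal_mul, Complex.ofReal_cpow (by positivity), Complex.ofReal_exp]
    push_cast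
    congr 2
    · rw [neg_neg]
    · rw [show (-(v * Complex.I) + u * Complex.I : ℂ) ^ 2 = - (u - v) ^ 2 by
        linear_combination (u - v : ℂ) ^ 2 * Complex.I_sq]
      have : (b : ℂ) ≠ 0 := by exact_mod_cast hb.ne'
      field_simp
      ring
  have hclosed : IsClosed ((fun r : ℝ => (r : ℂ)) '' Set.Ici 0) :=
    Complex.isometry_ofReal.isClosedEmbedding.isClosedMap _ isClosed_Ici
  obtain ⟨r, hr0, hr⟩ := hclosed.mem_of_tendsto hlim (Eventually.of_forall fun n => by
    obtain ⟨r, hr, h⟩ := hval n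
    exact ⟨r, hr, h.symm⟩)
  refine ⟨1 / (2 * Real.pi) * r, mul_nonneg (by positivity) hr0, ?_⟩
  unfold charFunInv
  rw [← hr]; push_cast; rfl

theorem charFunInv_re_nonneg (ν : Measure ℝ) [IsFiniteMeasure ν] (h : Integrable (charFun ν)) (v : ℝ) : 0 ≤ (charFunInv ν v).re := by
  obtain ⟨r, hr, h⟩ := exists_charFunInv_eq_ofReal ν h v
  simpa [h] using hr

theorem ofReal_charFunInv_re (ν : Measure ℝ) [IsFiniteMeasure ν] (h : Integrable (charFun ν)) (v : ℝ) :
    ((charFunInv ν v).re : ℂ) = charFunInv ν v := by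
  obtain ⟨r, hr, h⟩ := exists_charFunInv_eq_ofReal ν h v
  simp [h]

/-- A finite measure with integrable characteristic function has the inverse Fourier transform of
its characteristic function as its density. -/
theorem eq_withDensity_charFunInv (ν : Measure ℝ) [IsFiniteMeasure ν] (h : Integrable (charFun ν)) :
    ν = volume.withDensity fun v => ENNReal.ofReal (charFunInv ν v).re := by
  set g : ℝ → ℝ := fun v => (charFunInv ν v).re with hg
  have hgc : Continuous g := Complex.continuous_re.comp (continuous_charFunInv ν h)
  -- The candidate density `g` is bounded but not yet known to be integrable. The weight `exp (-u ^
  -- 2)` makes both sides finite measures, so that equality of characteristic functions suffices;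
  -- being positive and finite, it can be divided out afterwards.
  set w : ℝ → ℝ≥0∞ := fun u => ENNReal.ofReal (Real.exp (-u ^ 2)) with hw
  have hwm : Measurable w := by fun_prop
  have hwi : Integrable fun u : ℝ => Real.exp (-u ^ 2) := by
    simpa using integrable_exp_neg_mul_sq (b := 1) one_pos
  have hprod : Integrable fun u => Real.exp (-u ^ 2) * g u := by
    refine hwi.mul_bdd (c := ‖(1 / (2 * Real.pi) : ℂ)‖ * ∫ ξ, ‖charFun ν ξ‖)
      hgc.aestronglyMeasurable (ae_of_all _ fun u => ?_)
    exact (Complex.abs_re_le_norm _).trans (norm_charFunInv_le ν u)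
  have hν : IsFiniteMeasure (ν.withDensity w) := by
    refine isFiniteMeasure_withDensity_ofReal (Integrable.hasFiniteIntegral ?_)
    refine (integrable_const (1 : ℝ)).mono (by fun_prop) (ae_of_all _ fun u => ?_)
    simp only [Real.norm_eq_abs, abs_one, Real.abs_exp, Real.exp_le_one_iff]
    nlinarith [sq_nonneg u]
  have hg' : IsFiniteMeasure (volume.withDensity fun u => ENNReal.ofReal (Real.exp (-u ^ 2) * g u)) :=
    isFiniteMeasure_withDensity_ofReal hprod.hasFiniteIntegral
  have key : ν.withDensity w = volume.withDensity fun u =>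
      ENNReal.ofReal (Real.exp (-u ^ 2) * g u) := by
    refine Measure.ext_of_charFun (funext fun η => ?_)
    rw [charFun_apply_real, charFun_apply_real, integral_withDensity_eq_integral_toReal_smul hwm
      (ae_of_all _ fun _ => ENNReal.ofReal_lt_top), integral_withDensity_eq_integral_toReal_smul
      (by fun_prop) (ae_of_all _ fun _ => ENNReal.ofReal_lt_top)]
    -- The right side is the exponential in `integral_cexp_quadratic_mul_charFun` for `b = -1/4`, `c
    -- = η / 2`, `d = -η ^ 2 / 4`, the coefficients that appear in `e3` after the `u`-integration.
    have e1 : ∀ u : ℝ, (w u).toReal • Complex.exp (η * u * Complex.I) =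
        Complex.exp (-η ^ 2 / 4 - (η / 2 + u * Complex.I) ^ 2 / (4 * (-(1 / 4)))) := by
      intro u
      rw [hw]
      simp only
      rw [ENNReal.toReal_ofReal (by positivity), Complex.real_smul, Complex.ofReal_exp,
        ← Complex.exp_add]
      congr 1
      push_cast
      linear_combination (-u ^ 2 : ℂ) * Complex.I_sq
    have e2 : ∀ u : ℝ, (ENNReal.ofReal (Real.exp (-u ^ 2) * g u)).toReal •
        Complex.exp (η * u * Complex.I) =
        1 / (2 * Real.pi) * ∫ ξ : ℝ, Complex.exp (-u ^ 2 + (η - ξ) * Complex.I * u) *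
          charFun ν ξ := by
      intro u
      rw [ENNReal.toReal_ofReal (mul_nonneg (by positivity) (charFunInv_re_nonneg ν h u)),
        Complex.real_smul, Complex.ofReal_mul, ofReal_charFunInv_re ν h, Complex.ofReal_exp, charFunInv, mul_left_comm, mul_assoc,
        ← integral_const_mul, ← integral_mul_const]
      congr 1
      refine integral_congr_ae (ae_of_all _ fun ξ => ?_)
      simp only
      rw [← mul_assoc, mul_right_comm, ← Complex.exp_add, ← Complex.exp_add]
      congr 2
      push_cast
      ring
    simp_rw [e1, e2]
    have hint : Integrable (fun p : ℝ × ℝ => Complex.exp (-p.1 ^ 2 + (η - p.2) * Complex.I * p.1) *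
        charFun ν p.2) (volume.prod volume) := by
      refine (hwi.ofReal (𝕜 := ℂ) |>.mul_prod h).mono ((Continuous.aestronglyMeasurable
        (by fun_prop)).mul (h.aestronglyMeasurable.comp_snd)) (ae_of_all _ fun p => ?_)
      rw [norm_mul, norm_mul, Complex.norm_exp, RCLike.norm_ofReal, Real.abs_exp,
        show (-p.1 ^ 2 + (η - p.2) * Complex.I * p.1 : ℂ) =
          ((-p.1 ^ 2 : ℝ) : ℂ) + (((η - p.2) * p.1 : ℝ) : ℂ) * Complex.I by push_cast; ring,
        Complex.add_re, Complex.ofReal_re, Complex.re_ofReal_mul, Complex.I_re, mul_zero, add_zero]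
    rw [integral_const_mul, integral_integral_swap hint]
    have e3 : ∀ ξ : ℝ, ∫ u : ℝ, Complex.exp (-u ^ 2 + (η - ξ) * Complex.I * u) * charFun ν ξ =
        (Real.pi : ℂ) ^ (1 / 2 : ℂ) * (Complex.exp (-(1 / 4) * ξ ^ 2 + (η / 2) * ξ + -η ^ 2 / 4) *
          charFun ν ξ) := by
      intro ξ
      have := integral_cexp_quadratic (b := -1) (by simp) ((η - ξ) * Complex.I) 0
      simp only [neg_one_mul, add_zero, neg_neg, div_one] at this
      rw [integral_mul_const, this, mul_assoc]
      congr 3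
      rw [mul_pow, Complex.I_sq]
      ring
    simp_rw [e3]
    rw [integral_const_mul, integral_cexp_quadratic_mul_charFun ν (by norm_num),
      integral_const_mul, ← mul_assoc, ← mul_assoc]
    rw [show (1 : ℂ) / (2 * Real.pi) * Real.pi ^ (1 / 2 : ℂ) *
      (Real.pi / -(-(1 / 4))) ^ (1 / 2 : ℂ) = 1 from ?_, one_mul]
    have h4 : (Real.pi / -(-(1 / 4)) : ℂ) = ((Real.pi * 4 : ℝ) : ℂ) := by push_cast; ring
    have h5 : (1 / 2 : ℂ) = ((1 / 2 : ℝ) : ℂ) := by push_cast; rfl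
    rw [h4, h5, ← Complex.ofReal_cpow Real.pi_pos.le, ← Complex.ofReal_cpow (by positivity),
      ← Real.sqrt_eq_rpow, ← Real.sqrt_eq_rpow, Real.sqrt_mul Real.pi_pos.le,
      show √(4 : ℝ) = 2 by rw [show (4 : ℝ) = 2 ^ 2 by norm_num]; simp]
    norm_cast
    rw [mul_assoc, ← mul_assoc √Real.pi, Real.mul_self_sqrt Real.pi_pos.le]
    have := Real.pi_ne_zero
    field_simp
  have hinv : ∀ μ : Measure ℝ, (μ.withDensity w).withDensity (fun u => (w u)⁻¹) = μ := by
    intro μ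
    exact withDensity_inv_same hwm (ae_of_all _ fun u => by simp [hw, Real.exp_pos])
      (ae_of_all _ fun u => ENNReal.ofReal_ne_top)
  suffices h2 : (volume.withDensity fun v => ENNReal.ofReal (g v)).withDensity w =
      ν.withDensity w by rw [← hinv (volume.withDensity _), h2, hinv]
  rw [key, ← withDensity_mul _ (by fun_prop) hwm]
  congr 1
  funext u
  rw [Pi.mul_apply, hw, mul_comm, ENNReal.ofReal_mul (by positivity)]

/-! ### The Gamma function on vertical lines -/

theorem integrableOn_rpow_mul_exp_neg_mul {a r : ℝ} (ha : 0 < a) (hr : 0 < r) :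
    IntegrableOn (fun t : ℝ => t ^ (a - 1) * Real.exp (-(r * t))) (Set.Ioi 0) := by
  -- A non-integrable function has Bochner integral `0`, whereas the known value is positive.
  by_contra h
  have h1 := Real.integral_rpow_mul_exp_neg_mul_Ioi ha hr
  rw [integral_undef h] at h1
  have := Real.Gamma_pos_of_pos ha
  have : 0 < (1 / r) ^ a * Real.Gamma a := by positivity
  linarith

theorem norm_cpow_mul_cexp_neg_mul {t : ℝ} (ht : 0 < t) (a r : ℂ) :
    ‖(t : ℂ) ^ (a - 1) * Complex.exp (-(r * t))‖ = t ^ (a.re - 1) * Real.exp (-(r.re * t)) := by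
  rw [norm_mul, Complex.norm_cpow_eq_rpow_re_of_pos ht, Complex.norm_exp]
  simp

theorem hasDerivAt_integral_cpow_mul_cexp_neg_mul {a r : ℂ} (ha : 0 < a.re) (hr : 0 < r.re) :
    HasDerivAt (fun r : ℂ => ∫ t : ℝ in Set.Ioi 0, (t : ℂ) ^ (a - 1) * Complex.exp (-(r * t)))
      (∫ t : ℝ in Set.Ioi 0, (t : ℂ) ^ (a - 1) * (Complex.exp (-(r * t)) * (-t))) r := by
  have hmeas : ∀ a r : ℂ, AEStronglyMeasurable
      (fun t : ℝ => (t : ℂ) ^ (a - 1) * Complex.exp (-(r * t)))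
      (volume.restrict (Set.Ioi 0)) := fun a r => by
    refine Measurable.aestronglyMeasurable ?_
    fun_prop
  -- On the ball of radius `r.re / 2` about `r` the real part stays at least `r.re / 2`, which gives
  -- the dominating function; the factor `-t` raises the exponent by one.
  refine (hasDerivAt_integral_of_dominated_loc_of_deriv_le
    (F' := fun s t => (t : ℂ) ^ (a - 1) * (Complex.exp (-(s * t)) * (-t)))
    (bound := fun t => t ^ (a.re + 1 - 1) * Real.exp (-(r.re / 2 * t)))
    (Metric.ball_mem_nhds r (half_pos hr)) (Eventually.of_forall fun s => hmeas a s) ?_ ?_ ?_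
    (integrableOn_rpow_mul_exp_neg_mul (by linarith) (half_pos hr)) ?_).2
  · refine Integrable.mono (integrableOn_rpow_mul_exp_neg_mul ha hr) (hmeas a r) ?_
    filter_upwards [ae_restrict_mem measurableSet_Ioi] with t ht
    rw [norm_cpow_mul_cexp_neg_mul ht]
    exact le_abs_self _
  · refine Measurable.aestronglyMeasurable ?_
    fun_prop
  · filter_upwards [ae_restrict_mem measurableSet_Ioi] with t ht s hs
    have ht : 0 < t := ht
    have hs' : r.re / 2 ≤ s.re := by
      have h1 := (Complex.abs_re_le_norm (s - r)).trans (mem_ball_iff_norm.1 hs).le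
      rw [Complex.sub_re] at h1
      linarith [(abs_le.1 h1).1]
    rw [← mul_assoc, norm_mul, norm_cpow_mul_cexp_neg_mul ht, norm_neg, Complex.norm_real,
      Real.norm_of_nonneg ht.le, mul_right_comm, ← Real.rpow_add_one ht.ne']
    rw [show a.re - 1 + 1 = a.re + 1 - 1 by ring]
    gcongr
  · refine ae_of_all _ fun t s _ => ?_
    refine HasDerivAt.const_mul _ ?_
    have := ((hasDerivAt_id s).mul_const (t : ℂ)).neg.cexp
    simpa using this

/-- `∫₀^∞ t^{a-1} e^{-rt} dt = r^{-a} Γ(a)` for complex `a` and `r` with positive real parts. -/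
theorem integral_cpow_mul_cexp_neg_mul {a r : ℂ} (ha : 0 < a.re) (hr : 0 < r.re) :
    ∫ t : ℝ in Set.Ioi 0, (t : ℂ) ^ (a - 1) * Complex.exp (-(r * t)) =
      r ^ (-a) * Complex.Gamma a := by
  have hopen : IsOpen {s : ℂ | 0 < s.re} := isOpen_lt continuous_const Complex.continuous_re
  have h1 : AnalyticOnNhd ℂ
      (fun r : ℂ => ∫ t : ℝ in Set.Ioi 0, (t : ℂ) ^ (a - 1) * Complex.exp (-(r * t)))
      {s : ℂ | 0 < s.re} :=
    DifferentiableOn.analyticOnNhd (fun s hs =>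
      (hasDerivAt_integral_cpow_mul_cexp_neg_mul ha hs).differentiableAt.differentiableWithinAt)
      hopen
  have h2 : AnalyticOnNhd ℂ (fun r : ℂ => r ^ (-a) * Complex.Gamma a) {s : ℂ | 0 < s.re} :=
    DifferentiableOn.analyticOnNhd (fun s hs =>
      (((differentiableAt_id).cpow_const (Or.inl hs)).mul_const _).differentiableWithinAt) hopen
  -- Identity theorem: both sides agree at positive reals, and the points `1 + 1 / (n + 1)`
  -- accumulate at `1`.
  refine h1.eqOn_of_preconnected_of_frequently_eq h2
    (convex_halfSpace_re_gt 0).isPreconnected (z₀ := 1) (by simp) ?_ hr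
  have hreal : ∀ x : ℝ, 0 < x →
      ∫ t : ℝ in Set.Ioi 0, (t : ℂ) ^ (a - 1) * Complex.exp (-((x : ℂ) * t)) =
      (x : ℂ) ^ (-a) * Complex.Gamma a := fun x hx => by
    rw [Complex.integral_cpow_mul_exp_neg_mul_Ioi ha hx, one_div, Complex.cpow_neg,
      Complex.inv_cpow _ _ (by rw [Complex.arg_ofReal_of_nonneg hx.le]; exact Real.pi_pos.ne)]
  have hlim : Tendsto (fun n : ℕ => ((1 + 1 / ((n : ℝ) + 1) : ℝ) : ℂ)) atTop (𝓝[≠] 1) := by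
    refine tendsto_nhdsWithin_iff.2 ⟨?_, Eventually.of_forall fun n => ?_⟩
    · have := (tendsto_one_div_add_atTop_nhds_zero_nat (𝕜 := ℝ)).const_add 1
      rw [add_zero] at this
      exact_mod_cast (Complex.continuous_ofReal.tendsto _).comp this
    · have : (1 + 1 / ((n : ℝ) + 1) : ℝ) ≠ 1 := by
        have : 0 < 1 / ((n : ℝ) + 1) := by positivity
        linarith
      exact fun h => this (Complex.ofReal_injective (h.trans Complex.ofReal_one.symm))
  exact hlim.frequently (Frequently.of_forall fun n => hreal _ (by positivity))

/-- Exponential decay of `Γ` along vertical lines, at any rate below `π / 2`. -/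
theorem norm_Gamma_le_mul_exp {σ θ : ℝ} (hσ : 0 < σ) (hθ0 : 0 ≤ θ) (hθ : θ < Real.pi / 2) (y : ℝ) :
    ‖Complex.Gamma (σ + y * Complex.I)‖ ≤
      (Real.cos θ) ^ (-σ) * Real.Gamma σ * Real.exp (-(θ * |y|)) := by
  -- The ray of integration is rotated by `φ = ±θ`, the sign being that of `y`. Then `r ^ (-a)` has
  -- modulus `exp (θ |y|)` while the integral stays bounded uniformly in `y`.
  obtain ⟨φ, hφ, hφy⟩ : ∃ φ : ℝ, |φ| = θ ∧ φ * y = θ * |y| := by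
    rcases le_total 0 y with h | h
    · exact ⟨θ, abs_of_nonneg hθ0, by rw [abs_of_nonneg h]⟩
    · exact ⟨-θ, by rw [abs_neg, abs_of_nonneg hθ0], by rw [abs_of_nonpos h]; ring⟩
  have hcos : Real.cos φ = Real.cos θ := by rw [← hφ, Real.cos_abs]
  have hpos : 0 < Real.cos θ := Real.cos_pos_of_mem_Ioo ⟨by linarith [Real.pi_pos], hθ⟩
  have hre : (Complex.exp (φ * Complex.I)).re = Real.cos θ := by
    rw [Complex.exp_ofReal_mul_I_re, hcos]
  have ha : (σ + y * Complex.I : ℂ).re = σ := by simp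
  have h := integral_cpow_mul_cexp_neg_mul (a := σ + y * Complex.I)
    (r := Complex.exp (φ * Complex.I)) (by rwa [ha]) (by rwa [hre])
  have hb : ‖∫ t : ℝ in Set.Ioi 0, (t : ℂ) ^ ((σ + y * Complex.I : ℂ) - 1) *
      Complex.exp (-(Complex.exp (φ * Complex.I) * t))‖ ≤ (Real.cos θ) ^ (-σ) * Real.Gamma σ := by
    refine (norm_integral_le_integral_norm _).trans_eq ?_
    rw [Real.rpow_neg hpos.le, ← Real.inv_rpow hpos.le, ← one_div,
      ← Real.integral_rpow_mul_exp_neg_mul_Ioi hσ hpos]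
    refine setIntegral_congr_fun measurableSet_Ioi fun t ht => ?_
    rw [norm_cpow_mul_cexp_neg_mul ht, ha, hre]
  have hn : ‖Complex.exp (φ * Complex.I) ^ (-(σ + y * Complex.I : ℂ))‖ = Real.exp (θ * |y|) := by
    have hφ1 := abs_lt.1 (hφ.trans_lt hθ)
    rw [Complex.cpow_def_of_ne_zero (Complex.exp_ne_zero _), Complex.log_exp
      (by simp; linarith [Real.pi_pos]) (by simp; linarith [Real.pi_pos]), Complex.norm_exp, ← hφy]
    simp
  rw [h, norm_mul, hn] at hb
  rw [Real.exp_neg, ← div_eq_mul_inv, le_div_iff₀ (Real.exp_pos _), mul_comm]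
  exact hb

/-- The functional equation carries the bound to lines left of the imaginary axis: for `|y| ≥ 1` the
factor `τ + i y` has modulus at least `1`, and no pole is met. -/
theorem exists_norm_Gamma_le_mul_exp (τ : ℝ) {θ : ℝ} (hθ0 : 0 ≤ θ) (hθ : θ < Real.pi / 2) :
    ∃ C : ℝ, ∀ y : ℝ, 1 ≤ |y| →
      ‖Complex.Gamma (τ + y * Complex.I)‖ ≤ C * Real.exp (-(θ * |y|)) := by
  obtain ⟨n, hn⟩ := exists_nat_gt (-τ)
  induction n generalizing τ with
  | zero => exact ⟨_, fun y _ => norm_Gamma_le_mul_exp (by simpa using hn) hθ0 hθ y⟩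
  | succ n ih =>
    obtain ⟨C, hC⟩ := ih (τ + 1) (by push_cast at hn; linarith)
    refine ⟨C, fun y hy => le_trans ?_ (hC y hy)⟩
    have him : |y| ≤ ‖(τ + y * Complex.I : ℂ)‖ := by
      simpa using Complex.abs_im_le_norm (τ + y * Complex.I : ℂ)
    have hne : (τ + y * Complex.I : ℂ) ≠ 0 := norm_pos_iff.1 (by linarith)
    rw [show ((τ + 1 : ℝ) + y * Complex.I : ℂ) = τ + y * Complex.I + 1 by push_cast; ring,
      Complex.Gamma_add_one _ hne, norm_mul]
    exact le_mul_of_one_le_left (norm_nonneg _) (by linarith)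

theorem norm_sin_le_exp_abs_im (z : ℂ) : ‖Complex.sin z‖ ≤ Real.exp |z.im| := by
  rw [Complex.sin, norm_div, norm_mul, Complex.norm_I, mul_one, Complex.norm_two,
    div_le_iff₀ two_pos]
  refine (norm_sub_le _ _).trans ?_
  rw [Complex.norm_exp, Complex.norm_exp]
  simp only [Complex.mul_re, Complex.neg_re, Complex.I_re, mul_zero, Complex.neg_im, Complex.I_im,
    mul_one, zero_sub, neg_neg]
  linarith [Real.exp_le_exp.2 (le_abs_self z.im), Real.exp_le_exp.2 (neg_le_abs z.im)]

/-- By reflection `1 / Γ(s) = Γ(1 - s) sin (π s) / π`: the sine grows like `exp (π |y|)` and `Γ(1 -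
s)` gives back `exp (-θ |y|)`. -/
theorem exists_norm_inv_Gamma_le_mul_exp {σ θ : ℝ} (hσ : 0 < σ) (hθ0 : 0 ≤ θ)
    (hθ : θ < Real.pi / 2) :
    ∃ C : ℝ, ∀ y : ℝ, 1 ≤ |y| →
      ‖(Complex.Gamma (σ + y * Complex.I))⁻¹‖ ≤ C * Real.exp ((Real.pi - θ) * |y|) := by
  obtain ⟨C, hC⟩ := exists_norm_Gamma_le_mul_exp (1 - σ) hθ0 hθ
  refine ⟨C / Real.pi, fun y hy => ?_⟩
  have hG : Complex.Gamma (σ + y * Complex.I) ≠ 0 :=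
    Complex.Gamma_ne_zero_of_re_pos (by simpa using hσ)
  have hs : Complex.sin (Real.pi * (σ + y * Complex.I)) ≠ 0 := by
    intro h
    obtain ⟨k, hk⟩ := Complex.sin_eq_zero_iff.1 h
    have := congrArg Complex.im hk
    have hy0 : y = 0 := by simpa [Real.pi_ne_zero] using this
    norm_num [hy0] at hy
  have h := Complex.Gamma_mul_Gamma_one_sub (σ + y * Complex.I)
  have hinv : (Complex.Gamma (σ + y * Complex.I))⁻¹ = Complex.Gamma (1 - (σ + y * Complex.I)) *
      Complex.sin (Real.pi * (σ + y * Complex.I)) / Real.pi := by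
    have := Complex.ofReal_ne_zero.2 Real.pi_ne_zero
    rw [eq_div_iff hs] at h
    rw [eq_div_iff this, inv_mul_eq_iff_eq_mul₀ hG, ← mul_assoc]
    exact h.symm
  have h1 := hC (-y) (by rwa [abs_neg])
  rw [show ((1 - σ : ℝ) + (-y : ℝ) * Complex.I : ℂ) = 1 - (σ + y * Complex.I) by push_cast; ring,
    abs_neg] at h1
  have h2 := norm_sin_le_exp_abs_im (Real.pi * (σ + y * Complex.I))
  rw [Complex.im_ofReal_mul, Complex.add_im, Complex.ofReal_im, zero_add, Complex.im_ofReal_mul,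
    Complex.I_im, mul_one, abs_mul, abs_of_pos Real.pi_pos] at h2
  rw [hinv, norm_div, norm_mul, Complex.norm_real, Real.norm_of_nonneg Real.pi_pos.le,
    div_mul_eq_mul_div]
  refine div_le_div_of_nonneg_right ?_ Real.pi_pos.le
  calc _ ≤ C * Real.exp (-(θ * |y|)) * Real.exp (Real.pi * |y|) :=
        mul_le_mul h1 h2 (norm_nonneg _) ((norm_nonneg _).trans h1)
    _ = _ := by
      rw [mul_assoc, ← Real.exp_add]
      congr 2
      ring

theorem continuous_Gamma_vertical {σ : ℝ} (hσ : 0 < σ) {k : ℝ} (hk : 0 < k) :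
    Continuous fun y : ℝ => Complex.Gamma ((σ + y * Complex.I) * k) := by
  refine continuous_iff_continuousAt.2 fun y => ?_
  refine ContinuousAt.comp (f := fun y : ℝ => ((σ + y * Complex.I) * k : ℂ))
    (Complex.differentiableAt_Gamma _ fun m h => ?_).continuousAt
    (Continuous.continuousAt (by fun_prop))
  have := congrArg Complex.re h
  simp at this
  nlinarith [mul_pos hσ hk, (Nat.cast_nonneg m : (0 : ℝ) ≤ m)]

/-- Absolute integrability of `Γ(k s) / Γ(s)` along vertical lines `Re s > 0` for `k > 1`. -/
theorem integrable_Gamma_mul_div_Gamma {σ k : ℝ} (hσ : 0 < σ) (hk : 1 < k) :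
    Integrable fun y : ℝ => Complex.Gamma ((σ + y * Complex.I) * k) /
      Complex.Gamma (σ + y * Complex.I) := by
  have hk0 : 0 < k := by linarith
  have hpi := Real.pi_pos
  -- The quotient decays at rate `θ k - (π - θ) = θ (1 + k) - π`, positive for `θ > π / (1 + k)`; `k
  -- > 1` leaves room for such a `θ` below `π / 2`.
  obtain ⟨θ, hθ1, hθ⟩ := exists_between
    (show Real.pi / (1 + k) < Real.pi / 2 by gcongr; linarith)
  have hθ0 : 0 ≤ θ := le_trans (by positivity) hθ1.le
  rw [div_lt_iff₀ (by linarith)] at hθ1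
  obtain ⟨C, hC⟩ := exists_norm_inv_Gamma_le_mul_exp hσ hθ0 hθ
  set C' := Real.cos θ ^ (-(σ * k)) * Real.Gamma (σ * k) with hC'
  set δ := θ * (1 + k) - Real.pi with hδ
  have hδ0 : 0 < δ := by linarith
  have hcont : Continuous fun y : ℝ => Complex.Gamma ((σ + y * Complex.I) * k) /
      Complex.Gamma (σ + y * Complex.I) := by
    refine (continuous_Gamma_vertical hσ hk0).div
      (by simpa using continuous_Gamma_vertical hσ one_pos) fun y =>
      Complex.Gamma_ne_zero_of_re_pos (by simpa using hσ)
  have hbound : ∀ y : ℝ, 1 ≤ |y| → ‖Complex.Gamma ((σ + y * Complex.I) * k) /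
      Complex.Gamma (σ + y * Complex.I)‖ ≤ C' * C * Real.exp (-(δ * |y|)) := by
    intro y hy
    have h1 := norm_Gamma_le_mul_exp (mul_pos hσ hk0) hθ0 hθ (y * k)
    rw [show ((σ * k : ℝ) + (y * k : ℝ) * Complex.I : ℂ) = (σ + y * Complex.I) * k by
      push_cast; ring, abs_mul, abs_of_pos hk0] at h1
    rw [div_eq_mul_inv, norm_mul]
    calc _ ≤ C' * Real.exp (-(θ * (|y| * k))) * (C * Real.exp ((Real.pi - θ) * |y|)) :=
          mul_le_mul h1 (hC y hy) (norm_nonneg _) ((norm_nonneg _).trans h1)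
      _ = C' * C * (Real.exp (-(θ * (|y| * k))) * Real.exp ((Real.pi - θ) * |y|)) := by ring
      _ = _ := by
        rw [← Real.exp_add]
        congr 2
        rw [hδ]; ring
  have hexp : Integrable fun y : ℝ => Real.exp (-(δ * |y|)) := by
    rw [← integrableOn_univ, ← Set.Iic_union_Ioi (a := (0 : ℝ)), integrableOn_union]
    constructor
    · refine (integrableOn_exp_mul_Iic hδ0 0).congr_fun (fun y hy => ?_) measurableSet_Iic
      simp only
      rw [abs_of_nonpos hy, mul_neg, neg_neg]
    · refine (integrableOn_exp_mul_Ioi (neg_lt_zero.2 hδ0) 0).congr_fun (fun y hy => ?_)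
        measurableSet_Ioi
      simp only
      rw [abs_of_nonneg (le_of_lt hy), neg_mul]
  refine hcont.locallyIntegrable.integrable_of_isBigO_cocompact
    (g := fun y : ℝ => Real.exp (-(δ * |y|))) ?_ (hexp.integrableAtFilter _)
  refine Asymptotics.IsBigO.of_bound (C' * C) ?_
  filter_upwards [(isCompact_Icc (a := (-1 : ℝ)) (b := 1)).compl_mem_cocompact] with y hy
  rw [Real.norm_of_nonneg (Real.exp_pos _).le]
  refine hbound y (le_of_not_gt fun h => hy ?_)
  exact ⟨(abs_lt.1 h).1.le, (abs_lt.1 h).2.le⟩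

/-! ### The Laplace exponent of the stable Lévy measure -/

theorem lintegral_rpow_mul_exp_neg_mul {β u : ℝ} (hβ1 : β < 1) (hu : 0 < u) :
    ∫⁻ x in Set.Ioi (0 : ℝ), ENNReal.ofReal (x ^ (-β) * Real.exp (-(u * x))) =
      ENNReal.ofReal (u ^ (β - 1) * Real.Gamma (1 - β)) := by
  have h := Real.integral_rpow_mul_exp_neg_mul_Ioi (a := 1 - β) (by linarith) hu
  have hG := Real.Gamma_pos_of_pos (show 0 < 1 - β by linarith)
  have h2 : (1 / u) ^ (1 - β) = u ^ (β - 1) := by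
    rw [one_div, Real.inv_rpow hu.le, ← Real.rpow_neg hu.le, neg_sub]
  rw [h2, show 1 - β - 1 = -β by ring] at h
  have hint : IntegrableOn (fun x : ℝ => x ^ (-β) * Real.exp (-(u * x))) (Set.Ioi 0) := by
    by_contra hc
    rw [integral_undef hc] at h
    have : 0 < u ^ (β - 1) * Real.Gamma (1 - β) := by positivity
    linarith
  rw [← h, ofReal_integral_eq_lintegral_ofReal hint]
  filter_upwards [ae_restrict_mem measurableSet_Ioi] with x hx
  have : 0 < x := hx
  simp only [Pi.zero_apply]
  positivity

theorem lintegral_Ioc_mul_exp_neg_mul {s x : ℝ} (hs : 0 < s) (hx : 0 < x) :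
    ∫⁻ u in Set.Ioc 0 s, ENNReal.ofReal (x * Real.exp (-(u * x))) =
      ENNReal.ofReal (1 - Real.exp (-(s * x))) := by
  have hc : Continuous fun u : ℝ => x * Real.exp (-(u * x)) := by fun_prop
  rw [← ofReal_integral_eq_lintegral_ofReal
    ((hc.integrableOn_Icc (a := 0) (b := s)).mono_set Set.Ioc_subset_Icc_self)
    (ae_of_all _ fun u => by simp only [Pi.zero_apply]; positivity),
    ← intervalIntegral.integral_of_le hs.le,
    intervalIntegral.integral_eq_sub_of_hasDerivAt (f := fun u => -Real.exp (-(u * x)))]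
  · congr 1
    simp; ring
  · intro u _
    exact ((((hasDerivAt_id u).mul_const x).fun_neg.exp).fun_neg).congr_deriv (by simp; ring)
  · exact hc.intervalIntegrable _ _

theorem lintegral_Ioc_rpow_mul {β s G : ℝ} (hβ0 : 0 < β) (hs : 0 < s) (hG : 0 < G) :
    ∫⁻ u in Set.Ioc 0 s, ENNReal.ofReal (u ^ (β - 1) * G) = ENNReal.ofReal (s ^ β / β * G) := by
  have hi : IntervalIntegrable (fun u : ℝ => u ^ (β - 1)) volume 0 s :=
    intervalIntegral.intervalIntegrable_rpow' (by linarith)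
  rw [← ofReal_integral_eq_lintegral_ofReal
    (((intervalIntegrable_iff_integrableOn_Ioc_of_le hs.le).1 hi).mul_const G),
    ← intervalIntegral.integral_of_le hs.le, intervalIntegral.integral_mul_const,
    integral_rpow (Or.inl (by linarith))]
  · rw [sub_add_cancel, Real.zero_rpow hβ0.ne', sub_zero]
  · filter_upwards [ae_restrict_mem measurableSet_Ioc] with u hu
    have := hu.1
    simp only [Pi.zero_apply]
    positivity

/-- Write `1 - exp (-s x)` as `∫₀ˢ x exp (-u x) du` and apply Tonelli: the `x`-integral is a Gamma
integral, leaving a power of `u`. -/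
theorem lintegral_rpow_mul_one_sub_exp_neg {β s : ℝ} (hβ0 : 0 < β) (hβ1 : β < 1) (hs : 0 < s) :
    ∫⁻ x in Set.Ioi (0 : ℝ), ENNReal.ofReal (x ^ (-(1 + β)) * (1 - Real.exp (-(s * x)))) =
      ENNReal.ofReal (s ^ β / β * Real.Gamma (1 - β)) := by
  calc _ = ∫⁻ x in Set.Ioi (0 : ℝ), ∫⁻ u in Set.Ioc 0 s,
        ENNReal.ofReal (x ^ (-β) * Real.exp (-(u * x))) := by
        refine setLIntegral_congr_fun measurableSet_Ioi fun x hx => ?_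
        have hx : 0 < x := hx
        rw [ENNReal.ofReal_mul (by positivity), ← lintegral_Ioc_mul_exp_neg_mul hs hx,
          ← lintegral_const_mul _ (by fun_prop)]
        refine lintegral_congr fun u => ?_
        rw [← ENNReal.ofReal_mul (by positivity), ← mul_assoc, ← Real.rpow_add_one hx.ne']
        congr 3
        ring
    _ = ∫⁻ u in Set.Ioc 0 s, ∫⁻ x in Set.Ioi (0 : ℝ),
        ENNReal.ofReal (x ^ (-β) * Real.exp (-(u * x))) :=
        lintegral_lintegral_swap (Measurable.aemeasurable (by fun_prop))
    _ = ∫⁻ u in Set.Ioc 0 s, ENNReal.ofReal (u ^ (β - 1) * Real.Gamma (1 - β)) :=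
        setLIntegral_congr_fun measurableSet_Ioc fun u hu =>
          lintegral_rpow_mul_exp_neg_mul hβ1 hu.1
    _ = _ := lintegral_Ioc_rpow_mul hβ0 hs (Real.Gamma_pos_of_pos (by linarith))

/-- The Laplace exponent of the `β`-stable subordinator is `s ^ β`. -/
theorem laplaceExponent_stableLevyMeasure {β s : ℝ} (hβ0 : 0 < β) (hβ1 : β < 1) (hs : 0 < s) :
    laplaceExponent 0 (stableLevyMeasure β) s = s ^ β := by
  have hG := Real.Gamma_pos_of_pos (show 0 < 1 - β by linarith)
  rw [laplaceExponent, zero_mul, zero_add, stableLevyMeasure, restrict_withDensity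
    measurableSet_Ioi, Measure.restrict_restrict measurableSet_Ioi, Set.inter_self,
    integral_withDensity_eq_integral_toReal_smul (by fun_prop)
      (ae_of_all _ fun _ => ENNReal.ofReal_lt_top)]
  have h1 : ∀ x ∈ Set.Ioi (0 : ℝ),
      (ENNReal.ofReal (β / (Real.Gamma (1 - β) * x ^ (1 + β)))).toReal •
        (1 - Real.exp (-(s * x))) =
      β / Real.Gamma (1 - β) * (x ^ (-(1 + β)) * (1 - Real.exp (-(s * x)))) := by
    intro x hx
    have hx : 0 < x := hx
    rw [ENNReal.toReal_ofReal (by positivity), smul_eq_mul, Real.rpow_neg hx.le]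
    field_simp
  rw [setIntegral_congr_fun measurableSet_Ioi h1, integral_const_mul,
    integral_eq_lintegral_of_nonneg_ae, lintegral_rpow_mul_one_sub_exp_neg hβ0 hβ1 hs,
    ENNReal.toReal_ofReal (by positivity)]
  · field_simp
  · filter_upwards [ae_restrict_mem measurableSet_Ioi] with x hx
    have hx : 0 < x := hx
    have : Real.exp (-(s * x)) ≤ 1 := Real.exp_le_one_iff.2 (by nlinarith [mul_pos hs hx])
    exact mul_nonneg (by positivity) (by linarith)
  · exact Measurable.aestronglyMeasurable (by fun_prop)

/-! ### Moments of negative order -/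

theorem ofReal_rpow_cpow {x : ℝ} (hx : 0 < x) (a : ℝ) (z : ℂ) :
    ((x ^ a : ℝ) : ℂ) ^ z = (x : ℂ) ^ (a * z) := by
  rw [Complex.cpow_def_of_ne_zero (Complex.ofReal_ne_zero.2 (Real.rpow_pos_of_pos hx a).ne'),
    Complex.cpow_def_of_ne_zero (Complex.ofReal_ne_zero.2 hx.ne'), ← Complex.ofReal_log hx.le,
    ← Complex.ofReal_log (Real.rpow_pos_of_pos hx a).le, Real.log_rpow hx]
  push_cast
  ring_nf

/-- The substitution `s = x ^ (1 / β)` reduces this to a Gamma integral with parameter `r / β`. -/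
theorem integral_cpow_mul_exp_neg_mul_rpow {β t : ℝ} {r : ℂ} (hβ : 0 < β) (ht : 0 < t)
    (hr : 0 < r.re) :
    ∫ s : ℝ in Set.Ioi 0, (s : ℂ) ^ (r - 1) * (Real.exp (-(t * s ^ β)) : ℂ) =
      1 / β * ((1 / t) ^ (r / β) * Complex.Gamma (r / β)) := by
  have hβ' : (β : ℂ) ≠ 0 := by exact_mod_cast hβ.ne'
  have hre : (r / β).re = r.re / β := Complex.div_ofReal_re r β
  rw [← Complex.integral_cpow_mul_exp_neg_mul_Ioi (by rw [hre]; positivity) ht,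
    ← integral_comp_rpow_Ioi_of_pos (g := fun s : ℝ =>
      (s : ℂ) ^ (r - 1) * (Real.exp (-(t * s ^ β)) : ℂ)) (one_div_pos.2 hβ),
    ← integral_const_mul]
  refine setIntegral_congr_fun measurableSet_Ioi fun x hx => ?_
  have hx : 0 < x := hx
  have hx' : (x : ℂ) ≠ 0 := by exact_mod_cast hx.ne'
  rw [← Real.rpow_mul hx.le, one_div_mul_cancel hβ.ne', Real.rpow_one, Complex.real_smul,
    ofReal_rpow_cpow hx, Complex.ofReal_mul, Complex.ofReal_cpow hx.le,
    show r / β - 1 = ((1 / β - 1 : ℝ) : ℂ) + ((1 / β : ℝ) : ℂ) * (r - 1) by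
      push_cast; field_simp; ring,
    Complex.cpow_add _ _ hx', Complex.ofReal_exp]
  push_cast
  ring

section

variable {μ : Measure ℝ} {β t : ℝ}

theorem integrable_exp_neg_mul_of_laplace
    (hL : ∀ s : ℝ, 0 < s → ∫ x, Real.exp (-(s * x)) ∂μ = Real.exp (-(t * s ^ β)))
    {s : ℝ} (hs : 0 < s) : Integrable (fun x => Real.exp (-(s * x))) μ := by
  -- Otherwise the Bochner integral would be `0`, but `hL` makes it an exponential.
  by_contra h
  have := hL s hs
  rw [integral_undef h] at this
  exact (Real.exp_pos _).ne this

/-- On `(-∞, 0]` the function `exp (-s x)` is at least `1`, so the mass there is at most `exp (-t s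
^ β)`, which tends to `0` as `s → ∞`. -/
theorem measure_Iic_zero_of_laplace [IsFiniteMeasure μ] (hβ : 0 < β) (ht : 0 < t)
    (hL : ∀ s : ℝ, 0 < s → ∫ x, Real.exp (-(s * x)) ∂μ = Real.exp (-(t * s ^ β))) :
    μ (Set.Iic 0) = 0 := by
  have h1 : ∀ s : ℝ, 0 < s → μ.real (Set.Iic 0) ≤ Real.exp (-(t * s ^ β)) := by
    intro s hs
    have hi := integrable_exp_neg_mul_of_laplace hL hs
    calc μ.real (Set.Iic 0) = ∫ x in Set.Iic (0 : ℝ), (1 : ℝ) ∂μ := by simp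
      _ ≤ ∫ x in Set.Iic (0 : ℝ), Real.exp (-(s * x)) ∂μ := by
        refine setIntegral_mono_on (by simp) hi.integrableOn measurableSet_Iic fun x hx => ?_
        exact Real.one_le_exp (by nlinarith [Set.mem_Iic.1 hx])
      _ ≤ ∫ x, Real.exp (-(s * x)) ∂μ :=
        setIntegral_le_integral hi (ae_of_all _ fun x => (Real.exp_pos _).le)
      _ = _ := hL s hs
  have h2 : Tendsto (fun s : ℝ => Real.exp (-(t * s ^ β))) atTop (𝓝 0) :=
    Real.tendsto_exp_atBot.comp
      (tendsto_neg_atTop_atBot.comp ((tendsto_rpow_atTop hβ).const_mul_atTop ht))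
  have h3 : μ.real (Set.Iic 0) ≤ 0 :=
    ge_of_tendsto h2 ((eventually_gt_atTop 0).mono fun s hs => h1 s hs)
  exact (measureReal_eq_zero_iff).1 (le_antisymm h3 measureReal_nonneg)

/-- The Fubini condition for the moment formula: integrating the norm over `x` first leaves `s ^ (Re
r - 1) exp (-t s ^ β)`, which is integrable. -/
theorem integrable_cpow_mul_exp_prod_of_laplace [IsFiniteMeasure μ] (hβ : 0 < β) (ht : 0 < t)
    (hL : ∀ s : ℝ, 0 < s → ∫ x, Real.exp (-(s * x)) ∂μ = Real.exp (-(t * s ^ β)))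
    {r : ℂ} (hr : 0 < r.re) :
    Integrable (fun p : ℝ × ℝ => (p.2 : ℂ) ^ (r - 1) * (Real.exp (-(p.2 * p.1)) : ℂ))
      (μ.prod (volume.restrict (Set.Ioi 0))) := by
  have hnorm : ∀ s ∈ Set.Ioi (0 : ℝ), ∀ x : ℝ,
      ‖(s : ℂ) ^ (r - 1) * (Real.exp (-(s * x)) : ℂ)‖ =
        s ^ (r.re - 1) * Real.exp (-(s * x)) := by
    intro s hs x
    rw [norm_mul, Complex.norm_cpow_eq_rpow_re_of_pos hs, Complex.norm_real,
      Real.norm_of_nonneg (Real.exp_pos _).le, Complex.sub_re, Complex.one_re]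
  refine (integrable_prod_iff' (Measurable.aestronglyMeasurable (by fun_prop))).2 ⟨?_, ?_⟩
  · filter_upwards [ae_restrict_mem measurableSet_Ioi] with s hs
    exact ((integrable_exp_neg_mul_of_laplace hL hs).ofReal (𝕜 := ℂ)).const_mul _
  · have hi : IntegrableOn (fun s : ℝ => s ^ (r.re - 1) * Real.exp (-t * s ^ β)) (Set.Ioi 0) := by
      by_contra h
      have h1 := integral_rpow_mul_exp_neg_mul_rpow (q := r.re - 1) hβ (by linarith) ht
      rw [integral_undef h, sub_add_cancel] at h1
      have := Real.Gamma_pos_of_pos (div_pos hr hβ)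
      have : 0 < t ^ (-r.re / β) * (1 / β) * Real.Gamma (r.re / β) := by positivity
      linarith
    refine hi.congr_fun (fun s hs => ?_) measurableSet_Ioi
    simp only [hnorm s hs]
    rw [integral_const_mul, hL s hs, neg_mul]

theorem ae_integral_cpow_mul_exp_neg {r : ℂ} (hr : 0 < r.re) (h0 : μ (Set.Iic 0) = 0) :
    (fun x : ℝ => ∫ s : ℝ in Set.Ioi 0, (s : ℂ) ^ (r - 1) * (Real.exp (-(s * x)) : ℂ)) =ᵐ[μ]
      fun x : ℝ => (x : ℂ) ^ (-r) * Complex.Gamma r := by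
  have hpos : ∀ᵐ x ∂μ, 0 < x := by
    rw [ae_iff]; simpa [Set.Iic] using h0
  filter_upwards [hpos] with x hx
  have h := Complex.integral_cpow_mul_exp_neg_mul_Ioi hr hx
  rw [one_div, Complex.inv_cpow _ _
    (by rw [Complex.arg_ofReal_of_nonneg hx.le]; exact Real.pi_pos.ne), ← Complex.cpow_neg] at h
  rw [← h]
  refine integral_congr_ae (ae_of_all _ fun s => ?_)
  simp only
  push_cast
  rw [mul_comm (s : ℂ) x]

theorem integrable_cpow_neg_of_laplace [IsFiniteMeasure μ] (hβ : 0 < β) (ht : 0 < t)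
    (hL : ∀ s : ℝ, 0 < s → ∫ x, Real.exp (-(s * x)) ∂μ = Real.exp (-(t * s ^ β)))
    {r : ℂ} (hr : 0 < r.re) : Integrable (fun x : ℝ => (x : ℂ) ^ (-r)) μ := by
  -- Fubini makes the inner integral `Γ(r) x ^ (-r)` integrable in `x`; the nonzero constant `Γ(r)`
  -- is then removed.
  have h := ((integrable_cpow_mul_exp_prod_of_laplace hβ ht hL hr).integral_prod_left).congr
    (ae_integral_cpow_mul_exp_neg hr (measure_Iic_zero_of_laplace hβ ht hL))
  exact (integrable_mul_const_iff
    (isUnit_iff_ne_zero.2 (Complex.Gamma_ne_zero_of_re_pos hr)) _).1 h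

/-- The moments of negative order of a measure with Laplace transform `exp (-t s ^ β)`. -/
theorem integral_cpow_neg_of_laplace [IsFiniteMeasure μ] (hβ : 0 < β) (ht : 0 < t)
    (hL : ∀ s : ℝ, 0 < s → ∫ x, Real.exp (-(s * x)) ∂μ = Real.exp (-(t * s ^ β)))
    {r : ℂ} (hr : 0 < r.re) :
    ∫ x : ℝ, (x : ℂ) ^ (-r) ∂μ =
      1 / β * ((1 / t) ^ (r / β) * (Complex.Gamma (r / β) / Complex.Gamma r)) := by
  have hG := Complex.Gamma_ne_zero_of_re_pos hr
  have h := integral_integral_swap (f := fun x s : ℝ =>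
    (s : ℂ) ^ (r - 1) * (Real.exp (-(s * x)) : ℂ)) (integrable_cpow_mul_exp_prod_of_laplace hβ ht hL hr)
  rw [integral_congr_ae (ae_integral_cpow_mul_exp_neg hr (measure_Iic_zero_of_laplace hβ ht hL)),
    integral_mul_const] at h
  rw [← mul_div_assoc, ← mul_div_assoc, eq_div_iff hG, h,
    ← integral_cpow_mul_exp_neg_mul_rpow hβ ht hr]
  refine setIntegral_congr_fun measurableSet_Ioi fun s hs => ?_
  rw [integral_const_mul, integral_complex_ofReal, hL s hs]

end

/-! ### Mellin inversion through the logarithm -/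

/-- The image under `log` of the measure `x ^ (-σ) μ(dx)`. -/
noncomputable def logTilted (μ : Measure ℝ) (σ : ℝ) : Measure ℝ :=
  (μ.withDensity fun x => ENNReal.ofReal (x ^ (-σ))).map Real.log

/-- Change of variables `x = exp u`, whose Jacobian contributes `1 / x`. -/
theorem map_exp_withDensity (G : ℝ → ℝ≥0∞) :
    (volume.withDensity G).map Real.exp = volume.withDensity
      ((Set.Ioi 0).indicator fun x => ENNReal.ofReal x⁻¹ * G (Real.log x)) := by
  ext s hs
  rw [Measure.map_apply Real.measurable_exp hs, withDensity_apply _ (Real.measurable_exp hs),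
    withDensity_apply _ hs, lintegral_indicator measurableSet_Ioi,
    Measure.restrict_restrict measurableSet_Ioi]
  have himg : Real.exp '' (Real.exp ⁻¹' s) = Set.Ioi 0 ∩ s := by
    rw [Set.image_preimage_eq_inter_range, Real.range_exp, Set.inter_comm]
  rw [← himg, lintegral_image_eq_lintegral_abs_deriv_mul (Real.measurable_exp hs)
    (fun x _ => (Real.hasDerivAt_exp x).hasDerivWithinAt) Real.exp_injective.injOn]
  refine lintegral_congr fun u => ?_
  rw [Real.log_exp, ← mul_assoc, ← ENNReal.ofReal_mul (abs_nonneg _), Real.abs_exp,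
    mul_inv_cancel₀ (Real.exp_pos u).ne', ENNReal.ofReal_one, one_mul]

theorem ae_pos_of_measure_Iic_zero {μ : Measure ℝ} (h0 : μ (Set.Iic 0) = 0) : ∀ᵐ x ∂μ, 0 < x := by
  rw [ae_iff]; simpa [Set.Iic] using h0

theorem isFiniteMeasure_logTilted {μ : Measure ℝ} {σ : ℝ} (h0 : μ (Set.Iic 0) = 0)
    (hσ : Integrable (fun x : ℝ => (x : ℂ) ^ (-(σ : ℂ))) μ) :
    IsFiniteMeasure (logTilted μ σ) := by
  have : IsFiniteMeasure (μ.withDensity fun x => ENNReal.ofReal (x ^ (-σ))) := by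
    refine isFiniteMeasure_withDensity_ofReal (Integrable.hasFiniteIntegral ?_)
    refine hσ.norm.congr ?_
    filter_upwards [ae_pos_of_measure_Iic_zero h0] with x hx
    rw [Complex.norm_cpow_eq_rpow_re_of_pos hx, Complex.neg_re, Complex.ofReal_re]
  unfold logTilted
  infer_instance

/-- For `x > 0`, `x ^ (-σ) exp (i ξ log x) = x ^ (-(σ - i ξ))`; this identifies Fourier transform on
the log scale with Mellin transform on a vertical line. -/
theorem charFun_logTilted {μ : Measure ℝ} {σ : ℝ} (h0 : μ (Set.Iic 0) = 0)
    (ξ : ℝ) :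
    charFun (logTilted μ σ) ξ = ∫ x : ℝ, (x : ℂ) ^ (-(σ - ξ * Complex.I : ℂ)) ∂μ := by
  rw [charFun_apply_real, logTilted, integral_map Real.measurable_log.aemeasurable
    (Continuous.aestronglyMeasurable (by fun_prop)),
    integral_withDensity_eq_integral_toReal_smul (by fun_prop)
      (ae_of_all _ fun _ => ENNReal.ofReal_lt_top)]
  refine integral_congr_ae ?_
  filter_upwards [ae_pos_of_measure_Iic_zero h0] with x hx
  have hx' : (x : ℂ) ≠ 0 := by exact_mod_cast hx.ne'
  rw [ENNReal.toReal_ofReal (by positivity), Complex.real_smul, Complex.ofReal_cpow hx.le,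
    Complex.cpow_def_of_ne_zero hx', Complex.cpow_def_of_ne_zero hx', ← Complex.exp_add,
    Complex.ofReal_log hx.le]
  congr 1
  push_cast
  ring

theorem withDensity_rpow_eq_map_exp {μ : Measure ℝ} {σ : ℝ} (h0 : μ (Set.Iic 0) = 0)
    :
    μ.withDensity (fun x => ENNReal.ofReal (x ^ (-σ))) = (logTilted μ σ).map Real.exp := by
  rw [logTilted, Measure.map_map Real.measurable_exp Real.measurable_log]
  conv_lhs => rw [← Measure.map_id (μ := μ.withDensity fun x => ENNReal.ofReal (x ^ (-σ)))]
  refine Measure.map_congr ?_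
  have := (withDensity_absolutelyContinuous μ fun x => ENNReal.ofReal (x ^ (-σ))).ae_le
    (ae_pos_of_measure_Iic_zero h0)
  filter_upwards [this] with x hx
  exact (Real.exp_log hx).symm

/-- Mellin inversion for a finite measure on `(0,∞)`. -/
theorem eq_withDensity_of_integrable_charFun_logTilted {μ : Measure ℝ} {σ : ℝ} (h0 : μ (Set.Iic 0) = 0)
   
    (hσ : Integrable (fun x : ℝ => (x : ℂ) ^ (-(σ : ℂ))) μ)
    (hφ : Integrable (charFun (logTilted μ σ))) :
    μ = volume.withDensity ((Set.Ioi 0).indicator fun x => ENNReal.ofReal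
      (x ^ (σ - 1) * (charFunInv (logTilted μ σ) (Real.log x)).re)) := by
  have := isFiniteMeasure_logTilted h0 hσ
  have hm : Measurable fun v => (charFunInv (logTilted μ σ) v).re :=
    (Complex.continuous_re.comp (continuous_charFunInv _ hφ)).measurable
  set w : ℝ → ℝ≥0∞ := fun x => ENNReal.ofReal (x ^ (-σ)) with hw
  have hwm : Measurable w := by fun_prop
  have h1 : μ.withDensity w = volume.withDensity ((Set.Ioi 0).indicator fun x =>
      ENNReal.ofReal x⁻¹ * ENNReal.ofReal (charFunInv (logTilted μ σ) (Real.log x)).re) := by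
    rw [withDensity_rpow_eq_map_exp h0, ← map_exp_withDensity
      (fun v => ENNReal.ofReal (charFunInv (logTilted μ σ) v).re),
      ← eq_withDensity_charFunInv _ hφ]
  -- Removing the tilt multiplies by `x ^ σ`, which with the Jacobian `1 / x` gives the factor `x ^
  -- (σ - 1)`.
  have h2 : (μ.withDensity w).withDensity (fun x => (w x)⁻¹) = μ := by
    refine withDensity_inv_same hwm ?_ (ae_of_all _ fun u => ENNReal.ofReal_ne_top)
    filter_upwards [ae_pos_of_measure_Iic_zero h0] with x hx
    simpa [hw] using Real.rpow_pos_of_pos hx _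
  have hgm : Measurable ((Set.Ioi 0).indicator fun x => ENNReal.ofReal x⁻¹ *
      ENNReal.ofReal (charFunInv (logTilted μ σ) (Real.log x)).re) :=
    Measurable.indicator (Measurable.mul (by fun_prop)
      (hm.comp Real.measurable_log).ennreal_ofReal) measurableSet_Ioi
  rw [h1, ← withDensity_mul _ hgm (by fun_prop)] at h2
  conv_lhs => rw [← h2]
  congr 1
  funext x
  rw [Pi.mul_apply]
  by_cases hx : x ∈ Set.Ioi (0 : ℝ)
  · have hx0 : 0 < x := hx
    rw [Set.indicator_of_mem hx, Set.indicator_of_mem hx, hw,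
      ← ENNReal.ofReal_inv_of_pos (by positivity), ← ENNReal.ofReal_mul (by positivity),
      ← ENNReal.ofReal_mul' (by positivity), Real.rpow_sub_one hx0.ne', Real.rpow_neg hx0.le,
      inv_inv]
    congr 1
    field_simp
  · rw [Set.indicator_of_notMem hx, Set.indicator_of_notMem hx, zero_mul]

/-! ### The H-function with the stable parameters -/

section StableFox

variable {β : ℝ}

theorem foxKernel_stable (s : ℂ) :
    foxKernel 0 1 ![1 - 1 / (β : ℂ)] ![1 / β] ![(0 : ℂ)] ![(1 : ℝ)] s =
      Complex.Gamma ((1 - s) * (1 / β : ℝ)) / Complex.Gamma (1 - s) := by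
  simp only [foxKernel, Finset.prod_filter, Fin.prod_univ_one]
  simp only [Fin.val_zero, Nat.lt_irrefl, zero_lt_one, le_refl, if_true, if_false, mul_one,
    Matrix.cons_val_fin_one, Nat.not_le_of_lt, one_mul]
  congr 2 <;> push_cast <;> ring

/-- With `m = 0` nothing has to lie to the left. The singularities of `Γ((1 - s) / β)` are at `s = 1
+ β k`, and the leftmost is `s = 1`. -/
theorem isFoxContour_stable_iff (hβ : 0 < β) (c : ℝ) :
    IsFoxContour 0 1 ![1 - 1 / (β : ℂ)] ![1 / β] ![(0 : ℂ)] ![(1 : ℝ)] c ↔ c < 1 := by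
  refine ⟨fun h => ?_, fun hc => ⟨fun j hj => absurd hj (Nat.not_lt_zero _), ?_⟩⟩
  · simpa using h.right 0 Nat.zero_lt_one 0 1 (by simp)
  · intro i _ k s hs
    rw [Subsingleton.elim i 0] at hs
    simp only [Matrix.cons_val_zero] at hs
    have hre := congrArg Complex.re
      (show ((1 / β : ℝ) : ℂ) * (1 - s) = ((-(k : ℝ) : ℝ) : ℂ) by
        push_cast at hs ⊢; rw [← hs]; ring)
    rw [Complex.re_ofReal_mul, Complex.ofReal_re, Complex.sub_re, Complex.one_re,
      one_div, inv_mul_eq_iff_eq_mul₀ hβ.ne'] at hre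
    nlinarith [mul_nonneg hβ.le (Nat.cast_nonneg (α := ℝ) k)]

theorem norm_cpow_vertical {z : ℝ} (hz : 0 < z) (c y : ℝ) :
    ‖(z : ℂ) ^ (-(c + y * Complex.I : ℂ))‖ = z ^ (-c) := by
  rw [Complex.norm_cpow_eq_rpow_re_of_pos hz]
  simp

theorem foxIntegrand_stable (z c y : ℝ) :
    foxIntegrand 0 1 ![1 - 1 / (β : ℂ)] ![1 / β] ![(0 : ℂ)] ![(1 : ℝ)] z c y =
      Complex.Gamma (((1 - c : ℝ) + (-y : ℝ) * Complex.I) * (1 / β : ℝ)) /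
        Complex.Gamma ((1 - c : ℝ) + (-y : ℝ) * Complex.I) *
        (z : ℂ) ^ (-(c + y * Complex.I : ℂ)) := by
  rw [foxIntegrand, foxKernel_stable,
    show ((1 - c : ℝ) + (-y : ℝ) * Complex.I : ℂ) = 1 - (c + y * Complex.I) by push_cast; ring]

theorem integrable_foxIntegrand_stable (hβ0 : 0 < β) (hβ1 : β < 1) {z c : ℝ} (hz : 0 < z)
    (hc : c < 1) :
    Integrable (foxIntegrand 0 1 ![1 - 1 / (β : ℂ)] ![1 / β] ![(0 : ℂ)] ![(1 : ℝ)] z c) := by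
  have hk : 1 < 1 / β := by rw [lt_div_iff₀ hβ0]; linarith
  have h := (integrable_Gamma_mul_div_Gamma (σ := 1 - c) (by linarith) hk).comp_neg
  have hz' : (z : ℂ) ≠ 0 := by exact_mod_cast hz.ne'
  rw [show foxIntegrand 0 1 ![1 - 1 / (β : ℂ)] ![1 / β] ![(0 : ℂ)] ![(1 : ℝ)] (z : ℂ) c = _ from
    funext fun y => foxIntegrand_stable z c y]
  refine h.mul_bdd (c := z ^ (-c)) (Continuous.aestronglyMeasurable ?_)
    (ae_of_all _ fun y => (norm_cpow_vertical hz c y).le)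
  exact Continuous.const_cpow (by fun_prop) (Or.inl hz')

end StableFox

/-! ### The density and its Mellin-Barnes representation -/

section Density

variable {μ : Measure ℝ} [IsFiniteMeasure μ] {β t : ℝ}

/-- Put `s = c + i ξ` and `r = 1 - s`. Then `t ^ (-r / β) = t ^ (-1 / β) t ^ (s / β)`, so the powers
of `x` and `t` combine to `t ^ (-1 / β) (x / t ^ (1 / β)) ^ (-s)`: the inversion integrand is the
Mellin-Barnes integrand pointwise. -/
theorem rpow_mul_charFun_logTilted (hβ0 : 0 < β) (ht : 0 < t)
    (hL : ∀ s : ℝ, 0 < s → ∫ x, Real.exp (-(s * x)) ∂μ = Real.exp (-(t * s ^ β)))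
    {c x : ℝ} (hc : c < 1) (hx : 0 < x) (ξ : ℝ) :
    (x ^ (-c) : ℝ) * (Complex.exp (-(ξ * Real.log x * Complex.I)) *
      charFun (logTilted μ (1 - c)) ξ) =
    1 / ((β * t ^ (1 / β) : ℝ) : ℂ) * foxIntegrand 0 1 ![1 - 1 / (β : ℂ)] ![1 / β] ![(0 : ℂ)]
      ![(1 : ℝ)] ((x / t ^ (1 / β) : ℝ) : ℂ) c ξ := by
  have hT : 0 < t ^ (1 / β) := Real.rpow_pos_of_pos ht _
  have hβ' : (β : ℂ) ≠ 0 := by exact_mod_cast hβ0.ne'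
  rw [charFun_logTilted (measure_Iic_zero_of_laplace hβ0 ht hL),
    integral_cpow_neg_of_laplace hβ0 ht hL (by simpa using hc), foxIntegrand_stable,
    show ((1 - c : ℝ) + (-ξ : ℝ) * Complex.I : ℂ) = (1 - c : ℝ) - ξ * Complex.I by
      push_cast; ring]
  rw [show (((1 - c : ℝ) - ξ * Complex.I) * (1 / β : ℝ) : ℂ) =
    ((1 - c : ℝ) - ξ * Complex.I) / β by push_cast; ring]
  generalize hq : Complex.Gamma (((1 - c : ℝ) - ξ * Complex.I) / β) /
    Complex.Gamma ((1 - c : ℝ) - ξ * Complex.I) = q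
  have key : (x ^ (-c) : ℝ) * Complex.exp (-(ξ * Real.log x * Complex.I)) *
      (1 / t : ℂ) ^ (((1 - c : ℝ) - ξ * Complex.I : ℂ) / β) =
      ((t ^ (1 / β) : ℝ) : ℂ)⁻¹ * ((x / t ^ (1 / β) : ℝ) : ℂ) ^ (-(c + ξ * Complex.I : ℂ)) := by
    rw [← Complex.ofReal_inv, ← Real.rpow_neg ht.le, Real.rpow_def_of_pos hx,
      Real.rpow_def_of_pos ht, Complex.ofReal_exp, Complex.ofReal_exp,
      show (1 / t : ℂ) = ((t⁻¹ : ℝ) : ℂ) by push_cast; ring,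
      Complex.cpow_def_of_ne_zero (Complex.ofReal_ne_zero.2 (inv_pos.2 ht).ne'),
      Complex.cpow_def_of_ne_zero (Complex.ofReal_ne_zero.2 (div_pos hx hT).ne'),
      ← Complex.ofReal_log (div_pos hx hT).le, Real.log_div hx.ne' hT.ne', Real.log_rpow ht,
      ← Complex.ofReal_log (inv_pos.2 ht).le, Real.log_inv, ← Complex.exp_add,
      ← Complex.exp_add, ← Complex.exp_add]
    congr 1
    push_cast
    field_simp
    ring
  calc _ = 1 / β * ((x ^ (-c) : ℝ) * Complex.exp (-(ξ * Real.log x * Complex.I)) *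
      (1 / t : ℂ) ^ (((1 - c : ℝ) - ξ * Complex.I : ℂ) / β)) * q := by ring
    _ = _ := by
      rw [key, Complex.ofReal_mul, one_div_mul_eq_div, ← one_div_mul_one_div]
      ring

theorem integrable_charFun_logTilted (hβ0 : 0 < β) (hβ1 : β < 1) (ht : 0 < t)
    (hL : ∀ s : ℝ, 0 < s → ∫ x, Real.exp (-(s * x)) ∂μ = Real.exp (-(t * s ^ β)))
    {c : ℝ} (hc : c < 1) : Integrable (charFun (logTilted μ (1 - c))) := by
  -- At `x = 1` the prefactors are `1`, so the characteristic function itself is a constant multiple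
  -- of a Fox integrand.
  have h : charFun (logTilted μ (1 - c)) = _ :=
    funext fun ξ => by simpa using rpow_mul_charFun_logTilted hβ0 ht hL hc one_pos ξ
  rw [h]
  have := (integrable_foxIntegrand_stable hβ0 hβ1 (z := 1 / t ^ (1 / β)) (by positivity)
    hc).const_mul (1 / ((β * t ^ (1 / β) : ℝ) : ℂ))
  simpa using this

/-- The density obtained from the Mellin transform on the line `Re s = c`. -/
noncomputable def mellinDensity (μ : Measure ℝ) (c x : ℝ) : ℝ :=
  x ^ (-c) * (charFunInv (logTilted μ (1 - c)) (Real.log x)).re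

variable (hβ0 : 0 < β) (hβ1 : β < 1) (ht : 0 < t)
    (hL : ∀ s : ℝ, 0 < s → ∫ x, Real.exp (-(s * x)) ∂μ = Real.exp (-(t * s ^ β)))
    {c : ℝ} (hc : c < 1)

include hβ0 ht hL hc in
theorem isFiniteMeasure_logTilted_of_laplace : IsFiniteMeasure (logTilted μ (1 - c)) :=
  isFiniteMeasure_logTilted (measure_Iic_zero_of_laplace hβ0 ht hL)
    (integrable_cpow_neg_of_laplace hβ0 ht hL (by simpa using hc))

include hβ0 hβ1 ht hL hc

theorem mellinDensity_nonneg {x : ℝ} (hx : 0 < x) : 0 ≤ mellinDensity μ c x := by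
  have := isFiniteMeasure_logTilted_of_laplace hβ0 ht hL hc
  exact mul_nonneg (by positivity)
    (charFunInv_re_nonneg _ (integrable_charFun_logTilted hβ0 hβ1 ht hL hc) _)

theorem continuousOn_mellinDensity : ContinuousOn (mellinDensity μ c) (Set.Ioi 0) := by
  have h := Complex.continuous_re.comp
    (continuous_charFunInv _ (integrable_charFun_logTilted hβ0 hβ1 ht hL hc))
  refine ContinuousOn.mul (fun x hx => ?_) (h.comp_continuousOn
    (Real.continuousOn_log.mono fun x hx => (ne_of_gt hx)))
  exact (Real.continuousAt_rpow_const x (-c) (Or.inl (ne_of_gt hx))).continuousWithinAt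

theorem eq_withDensity_mellinDensity :
    μ = volume.withDensity ((Set.Ioi 0).indicator fun x => ENNReal.ofReal (mellinDensity μ c x)) := by
  have h := eq_withDensity_of_integrable_charFun_logTilted
    (measure_Iic_zero_of_laplace hβ0 ht hL)
    (integrable_cpow_neg_of_laplace hβ0 ht hL (by simpa using hc))
    (integrable_charFun_logTilted hβ0 hβ1 ht hL hc)
  rwa [show 1 - c - 1 = -c by ring] at h

theorem ofReal_mellinDensity {x : ℝ} (hx : 0 < x) :
    (mellinDensity μ c x : ℂ) = 1 / ((β * t ^ (1 / β) : ℝ) : ℂ) *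
      foxIntegral 0 1 ![1 - 1 / (β : ℂ)] ![1 / β] ![(0 : ℂ)] ![(1 : ℝ)]
        ((x / t ^ (1 / β) : ℝ) : ℂ) c := by
  have := isFiniteMeasure_logTilted_of_laplace hβ0 ht hL hc
  rw [mellinDensity, Complex.ofReal_mul,
    ofReal_charFunInv_re _ (integrable_charFun_logTilted hβ0 hβ1 ht hL hc), charFunInv,
    foxIntegral, integral_mul_const, mul_left_comm, ← integral_const_mul,
    integral_congr_ae (ae_of_all _ fun ξ => rpow_mul_charFun_logTilted hβ0 ht hL hc hx ξ),
    integral_const_mul]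
  have := Complex.ofReal_ne_zero.2 Real.pi_ne_zero
  have := Complex.I_ne_zero
  field_simp

/-- Both are densities of `μ`, hence equal almost everywhere on `(0,∞)`, and continuity there
removes the exceptional set. This replaces a contour shift. -/
theorem eqOn_mellinDensity {c' : ℝ} (hc' : c' < 1) :
    Set.EqOn (mellinDensity μ c) (mellinDensity μ c') (Set.Ioi 0) := by
  have hcont := continuousOn_mellinDensity hβ0 hβ1 ht hL hc
  have hcont' := continuousOn_mellinDensity hβ0 hβ1 ht hL hc'
  refine Measure.eqOn_open_of_ae_eq (μ := volume) ?_ isOpen_Ioi hcont hcont'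
  have hm : ∀ {f : ℝ → ℝ}, ContinuousOn f (Set.Ioi 0) →
      AEMeasurable ((Set.Ioi 0).indicator fun x => ENNReal.ofReal (f x)) := fun hf =>
    (aemeasurable_indicator_iff measurableSet_Ioi).2
      (hf.aemeasurable measurableSet_Ioi).ennreal_ofReal
  have h := (withDensity_eq_iff_of_sigmaFinite (hm hcont) (hm hcont')).1
    ((eq_withDensity_mellinDensity hβ0 hβ1 ht hL hc).symm.trans
      (eq_withDensity_mellinDensity hβ0 hβ1 ht hL hc'))
  filter_upwards [ae_restrict_of_ae h, ae_restrict_mem measurableSet_Ioi] with x hx hx0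
  rw [Set.indicator_of_mem hx0, Set.indicator_of_mem hx0] at hx
  exact (ENNReal.ofReal_eq_ofReal_iff (mellinDensity_nonneg hβ0 hβ1 ht hL hc hx0)
    (mellinDensity_nonneg hβ0 hβ1 ht hL hc' hx0)).1 hx

theorem foxIntegral_stable_eq {c' : ℝ} (hc' : c' < 1) {x : ℝ} (hx : 0 < x) :
    foxIntegral 0 1 ![1 - 1 / (β : ℂ)] ![1 / β] ![(0 : ℂ)] ![(1 : ℝ)]
        ((x / t ^ (1 / β) : ℝ) : ℂ) c =
      foxIntegral 0 1 ![1 - 1 / (β : ℂ)] ![1 / β] ![(0 : ℂ)] ![(1 : ℝ)]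
        ((x / t ^ (1 / β) : ℝ) : ℂ) c' := by
  have hne : 1 / ((β * t ^ (1 / β) : ℝ) : ℂ) ≠ 0 :=
    one_div_ne_zero (Complex.ofReal_ne_zero.2 (by positivity))
  refine mul_left_cancel₀ hne ?_
  rw [← ofReal_mellinDensity hβ0 hβ1 ht hL hc hx, ← ofReal_mellinDensity hβ0 hβ1 ht hL hc' hx,
    eqOn_mellinDensity hβ0 hβ1 ht hL hc hc' hx]

theorem foxHWellDefined_stable {x : ℝ} (hx : 0 < x) :
    FoxHWellDefined 0 1 ![1 - 1 / (β : ℂ)] ![1 / β] ![(0 : ℂ)] ![(1 : ℝ)]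
      ((x / t ^ (1 / β) : ℝ) : ℂ) where
  m_le := Nat.zero_le _
  n_le := le_refl _
  A_pos i := by rw [Subsingleton.elim i 0]; simpa using hβ0
  B_pos j := by rw [Subsingleton.elim j 0]; simp
  z_ne_zero := Complex.ofReal_ne_zero.2 (by positivity)
  exists_contour := ⟨c, (isFoxContour_stable_iff hβ0 c).2 hc⟩
  integrable c' h := integrable_foxIntegrand_stable hβ0 hβ1 (by positivity)
    ((isFoxContour_stable_iff hβ0 c').1 h)
  eq_of_contour c₁ c₂ h₁ h₂ := foxIntegral_stable_eq hβ0 hβ1 ht hL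
    ((isFoxContour_stable_iff hβ0 c₁).1 h₁) ((isFoxContour_stable_iff hβ0 c₂).1 h₂) hx

theorem ofReal_mellinDensity_eq_foxH {x : ℝ} (hx : 0 < x) :
    (mellinDensity μ c x : ℂ) = 1 / ((β * t ^ (1 / β) : ℝ) : ℂ) *
      foxH 0 1 ![1 - 1 / (β : ℂ)] ![1 / β] ![(0 : ℂ)] ![(1 : ℝ)]
        ((x / t ^ (1 / β) : ℝ) : ℂ) := by
  have h : ∃ c : ℝ, IsFoxContour 0 1 ![1 - 1 / (β : ℂ)] ![1 / β] ![(0 : ℂ)] ![(1 : ℝ)] c :=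
    ⟨c, (isFoxContour_stable_iff hβ0 c).2 hc⟩
  rw [foxH, dif_pos h, ofReal_mellinDensity hβ0 hβ1 ht hL hc hx]
  congr 1
  exact foxIntegral_stable_eq hβ0 hβ1 ht hL hc
    ((isFoxContour_stable_iff hβ0 _).1 h.choose_spec) hx

end Density

theorem mainTheorem1 {Ω : Type*} [MeasurableSpace Ω] (P : Measure Ω) [IsProbabilityMeasure P]
    (β : ℝ) (hβ0 : 0 < β) (hβ1 : β < 1)
    (D : ℝ≥0 → Ω → ℝ) (hD : IsStableSubordinator D P β)
    (t : ℝ≥0) (ht : 0 < t) :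
    ∃ f : ℝ → ℝ,
      -- `f` is the density of `D t`, in its version that is continuous on `(0,∞)`
      (∀ x, 0 ≤ f x) ∧ (∀ x ≤ 0, f x = 0) ∧ ContinuousOn f (Set.Ioi 0) ∧
      P.map (D t) = volume.withDensity (fun x => ENNReal.ofReal (f x)) ∧
      -- the representation by Fox's H-function
      ∀ x : ℝ, 0 < x →
        FoxHWellDefined 0 1 ![1 - 1 / (β : ℂ)] ![1 / β] ![(0 : ℂ)] ![(1 : ℝ)]
          ((x / (t : ℝ) ^ (1 / β) : ℝ) : ℂ) ∧
        (f x : ℂ) = 1 / ((β * (t : ℝ) ^ (1 / β) : ℝ) : ℂ) *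
          foxH 0 1 ![1 - 1 / (β : ℂ)] ![1 / β] ![(0 : ℂ)] ![(1 : ℝ)]
            ((x / (t : ℝ) ^ (1 / β) : ℝ) : ℂ) := by
  have hL : ∀ s : ℝ, 0 < s →
      ∫ x, Real.exp (-(s * x)) ∂(P.map (D t)) = Real.exp (-((t : ℝ) * s ^ β)) := by
    intro s hs
    rw [integral_map (hD.measurable t).aemeasurable
      (Continuous.aestronglyMeasurable (by fun_prop)), hD.laplace t s hs,
      laplaceExponent_stableLevyMeasure hβ0 hβ1 hs]
  have ht' : 0 < (t : ℝ) := by exact_mod_cast ht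
  -- Any `c < 1` would serve: the density is taken on the line `c = 0`, and `c = 1/2` merely
  -- witnesses that a contour exists.
  refine ⟨(Set.Ioi 0).indicator (mellinDensity (P.map (D t)) 0), fun x => ?_, fun x hx => ?_,
    ?_, ?_, fun x hx => ⟨foxHWellDefined_stable hβ0 hβ1 ht' hL one_half_lt_one hx, ?_⟩⟩
  · exact Set.indicator_nonneg (fun x hx => mellinDensity_nonneg hβ0 hβ1 ht' hL one_pos hx) x
  · exact Set.indicator_of_notMem (not_lt.2 hx) _
  · exact (continuousOn_mellinDensity hβ0 hβ1 ht' hL one_pos).congr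
      fun x hx => Set.indicator_of_mem hx _
  · conv_lhs => rw [eq_withDensity_mellinDensity hβ0 hβ1 ht' hL one_pos]
    congr 1
    funext x
    by_cases hx : x ∈ Set.Ioi (0 : ℝ)
    · rw [Set.indicator_of_mem hx, Set.indicator_of_mem hx]
    · rw [Set.indicator_of_notMem hx, Set.indicator_of_notMem hx, ENNReal.ofReal_zero]
  · rw [Set.indicator_of_mem (Set.mem_Ioi.2 hx)]
    exact ofReal_mellinDensity_eq_foxH hβ0 hβ1 ht' hL one_pos hx
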